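/- All rings are associative with identity, subrings are unital, and "ideal" means two-sided ideal. For a subring $R$ of a ring $T$ put $(R:T)=\{x\in T: TxT\subseteq R\}$, $(R:T)_l=\{x\in T: Tx\subseteq R\}$, $(R:T)_r=\{x\in T: xT\subseteq R\}$. A subring $R\subsetneq T$ is a maximal subring of $T$ if no subring lies strictly between $R$ and $T$. Write $J(A)$ for the Jacobson radical, $\mathrm{Spec}(A)$ and $\mathrm{Max}(A)$ for the sets of prime and of maximal ideals of a ring $A$, $\dim A$ for the supremum of the lengths of chains of prime ideals of $A$, and $\mathrm{ht}(Q)$ for the supremum of the lengths of chains of prime ideals contained in a prime ideal $Q$ (ending at $Q$). Theorem. Let $R$ be a maximal subring of a ring $T$ such that $R$ is left Artinian and $(R:T)_l=(R:T)=(R:T)_r$. Then there are an integer $n\ge 1$ and a ring $S$ having a maximal subring which is a division ring, such that $T/(R:T)\cong \mathbb{M}_n(S)$ as rings and the following hold. (A) Either $T$ is left Artinian and $J(R)=J(T)\cap R$, or $S$ and $T/(R:T)$ each have at most one nonzero proper ideal and one of the following holds: (1) $S$ is a simple ring and $(R:T)$ is a maximal ideal of $T$; (2) $S$ has a unique nonzero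 proper ideal $M$, $M^2=0$, and $J(S)=M$; (3) $S$ has a unique nonzero proper ideal $M$, $M^2=M$, and either $S$ is left and right primitive or $J(S)=M$. (B) If $S$ has at most one nonzero proper ideal (in particular, in each of the cases (1)–(3)), then $T$ has a unique maximal ideal $Q$ containing $(R:T)$, and: (a) $\mathrm{Max}(T)=\{Q\}\cup\{N\in \mathrm{Spec}(T): N\nsubseteq R\}$; (b) every prime ideal of $T$ is maximal or is contained in $Q$, and $\dim T=\mathrm{ht}(Q)$; (c) if $N_1\neq N_2$ are maximal ideals of $T$, both different from $Q$, then $N_1\cap R\neq N_2\cap R$; (d) $|\mathrm{Max}(T)|\le|\mathrm{Max}(R)|$. -/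

import Mathlib

namespace MaxSubring

universe u

/-- `R` is a maximal subring of `T`: `R ≠ T` and no subring lies strictly between `R` and `T`. -/
def IsMaximalSubring {T : Type u} [Ring T] (R : Subring T) : Prop :=
  R ≠ ⊤ ∧ ∀ R' : Subring T, R < R' → R' = ⊤

/-- The conductor `(R:T) = {x ∈ T | TxT ⊆ R}`, as a two-sided ideal of `T`. -/
def conductor {T : Type u} [Ring T] (R : Subring T) : TwoSidedIdeal T :=
  TwoSidedIdeal.mk' {x : T | ∀ a b : T, a * x * b ∈ R}
    (by intro a b; simp)
    (by intro x y hx hy a b; rw [mul_add, add_mul]; exact R.add_mem (hx a b) (hy a b))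
    (by intro x hx a b; rw [mul_neg, neg_mul]; exact R.neg_mem (hx a b))
    (by intro x y hy a b; rw [← mul_assoc a x y]; exact hy (a * x) b)
    (by intro x y hx a b; rw [← mul_assoc a x y, mul_assoc (a * x) y b]; exact hx a (y * b))

/-- The left conductor `(R:T)_l = {x ∈ T | Tx ⊆ R}`. -/
def leftConductor {T : Type u} [Ring T] (R : Subring T) : Set T :=
  {x : T | ∀ t : T, t * x ∈ R}

/-- The right conductor `(R:T)_r = {x ∈ T | xT ⊆ R}`. -/
def rightConductor {T : Type u} [Ring T] (R : Subring T) : Set T :=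
  {x : T | ∀ t : T, x * t ∈ R}

/-- A division ring, as a property of a (possibly noncommutative) ring. -/
def IsDivisionRing (D : Type u) [Ring D] : Prop :=
  Nontrivial D ∧ ∀ d : D, d ≠ 0 → IsUnit d

/-- Maximal (two-sided) ideals. -/
def IsMaximalIdeal {A : Type u} [Ring A] (M : TwoSidedIdeal A) : Prop :=
  M ≠ ⊤ ∧ ∀ I : TwoSidedIdeal A, M < I → I = ⊤

/-- Prime (two-sided) ideals of a noncommutative ring: `P` is proper and `I J ⊆ P` implies
`I ⊆ P` or `J ⊆ P`, for all ideals `I`, `J`. -/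
def IsPrimeIdeal {A : Type u} [Ring A] (P : TwoSidedIdeal A) : Prop :=
  P ≠ ⊤ ∧ ∀ I J : TwoSidedIdeal A, (∀ x ∈ I, ∀ y ∈ J, x * y ∈ P) → I ≤ P ∨ J ≤ P

/-- The set of maximal ideals. -/
def Max (A : Type u) [Ring A] : Set (TwoSidedIdeal A) := {M | IsMaximalIdeal M}

/-- The set of prime ideals, ordered by inclusion when regarded as a type. -/
def Spec (A : Type u) [Ring A] : Set (TwoSidedIdeal A) := {P | IsPrimeIdeal P}

/-- The classical Krull dimension: the supremum of the lengths of chains of prime ideals. -/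
noncomputable def dim (A : Type u) [Ring A] : WithBot ℕ∞ := Order.krullDim (Spec A)

/-- The contraction `N ∩ R` of an ideal `N` of `T`, as an ideal of `R`. -/
def contract {T : Type u} [Ring T] (R : Subring T) (N : TwoSidedIdeal T) : TwoSidedIdeal R :=
  N.comap R.subtype

/-- A left primitive ring: it has a faithful simple left module. (Simple modules are quotients of
the ring, so it suffices to look in the universe of the ring.) -/
def IsLeftPrimitive (A : Type u) [Ring A] : Prop :=
  ∃ (V : Type u) (_ : AddCommGroup V) (_ : Module A V), IsSimpleModule A V ∧ FaithfulSMul A V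

/-- A right primitive ring: its opposite ring is left primitive. -/
def IsRightPrimitive (A : Type u) [Ring A] : Prop := IsLeftPrimitive Aᵐᵒᵖ

/-- There is at most one nonzero proper ideal. -/
def AtMostOneIdeal (A : Type u) [Ring A] : Prop :=
  ∀ I J : TwoSidedIdeal A, I ≠ ⊥ → I ≠ ⊤ → J ≠ ⊥ → J ≠ ⊤ → I = J

/-- `M` is the unique nonzero proper ideal. -/
def IsUniqueIdeal {A : Type u} [Ring A] (M : TwoSidedIdeal A) : Prop :=
  M ≠ ⊥ ∧ M ≠ ⊤ ∧ ∀ I : TwoSidedIdeal A, I ≠ ⊥ → I ≠ ⊤ → I = M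

/-- `S` and `T/(R:T)` have at most one nonzero proper ideal, and one of three cases holds:
`S` is simple (and `(R:T)` is a maximal ideal of `T`); or `S` has a unique nonzero proper ideal
`M`, with `M² = 0` (and `J(S) = M`); or `S` has a unique nonzero proper ideal `M`, with `M² = M`
(and `S` is a left and right primitive ring or `J(S) = M`). -/
def FewIdeals {T : Type u} [Ring T] (R : Subring T) (S : Type u) [Ring S] : Prop :=
  AtMostOneIdeal S ∧ AtMostOneIdeal (conductor R).ringCon.Quotient ∧
  ((IsSimpleRing S ∧ IsMaximalIdeal (conductor R)) ∨
   (∃ M : TwoSidedIdeal S, IsUniqueIdeal M ∧ M.asIdeal * M.asIdeal = ⊥ ∧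
      Ring.jacobson S = M.asIdeal) ∨
   (∃ M : TwoSidedIdeal S, IsUniqueIdeal M ∧ M.asIdeal * M.asIdeal = M.asIdeal ∧
      ((IsLeftPrimitive S ∧ IsRightPrimitive S) ∨ Ring.jacobson S = M.asIdeal)))

end MaxSubring

/-! Write C = (R:T). As the left conductor is C, the maximal subring R/C of T/C has zero left
conductor. An idealizer argument (`prime_of_leftConductor`) makes R/C prime. Being left Artinian, it
is simple, hence a matrix ring over a division ring. Its matrix units split T/C as 𝕄ₙ(S), with S
their centralizer, and R/C becomes 𝕄ₙ(D) for a division ring D maximal in S (`exists_matrix`).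

For (A), a nonzero proper ideal I of S satisfies S = D + I, so it is a maximal left ideal. Two
distinct ones meet in 0, so S embeds in S/I × S/J and is left Artinian; this passes to T/C, and then
to T because C ⊆ R. If there is at most one such ideal M, then M² is 0 or M, and `trichotomy`
compares M with J(S).

For (B), a prime N ⊄ R gives T = R + N, so T/N is a prime quotient of R, hence simple, and N is
maximal. Primes inside R lie in C ⊆ Q. Contractions separate the maximal ideals other than Q because
C·N₁ ⊆ N₁ ∩ R. -/

namespace MaxSubring

universe u

/-! ### Two-sided ideals, primeness, and Artinian prime rings. -/

section Ideals

variable {A B : Type u} [Ring A] [Ring B]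

theorem eq_bot_iff_forall {I : TwoSidedIdeal A} : I = ⊥ ↔ ∀ x ∈ I, x = 0 := by
  constructor
  · rintro rfl x hx
    exact TwoSidedIdeal.mem_bot A |>.1 hx
  · intro h
    ext x
    rw [TwoSidedIdeal.mem_bot]
    exact ⟨h x, fun hx => hx ▸ I.zero_mem⟩

theorem exists_mem_ne_zero {I : TwoSidedIdeal A} (h : I ≠ ⊥) : ∃ x ∈ I, x ≠ 0 := by
  by_contra! h'
  exact h (eq_bot_iff_forall.2 h')

theorem eq_top_iff_one_mem {I : TwoSidedIdeal A} : I = ⊤ ↔ (1 : A) ∈ I :=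
  (I.one_mem_iff).symm

/-- Elementwise form of primeness of a two-sided ideal. -/
theorem IsPrimeIdeal.mem_or_mem {P : TwoSidedIdeal A} (hP : IsPrimeIdeal P) {a b : A}
    (h : ∀ r, a * r * b ∈ P) : a ∈ P ∨ b ∈ P := by
  -- Modulo P, `J` is the right annihilator of aA and `I` the left annihilator of `J`. So IJ ⊆ P by
  -- construction, with a ∈ I and b ∈ J.
  let J : TwoSidedIdeal A := TwoSidedIdeal.mk' {y | ∀ r, a * r * y ∈ P}
    (by intro r; simp)
    (by intro x y hx hy r; rw [mul_add]; exact P.add_mem (hx r) (hy r))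
    (by intro x hx r; rw [mul_neg]; exact P.neg_mem (hx r))
    (by intro x y hy r; rw [← mul_assoc, mul_assoc a]; exact hy (r * x))
    (by intro x y hx r; rw [← mul_assoc]; exact P.mul_mem_right _ _ (hx r))
  have memJ : ∀ y, y ∈ J ↔ ∀ r, a * r * y ∈ P := fun y => by simp [J]
  let I : TwoSidedIdeal A := TwoSidedIdeal.mk' {x | ∀ y ∈ J, x * y ∈ P}
    (by intro r _; simp)
    (by intro x y hx hy r hr; rw [add_mul]; exact P.add_mem (hx r hr) (hy r hr))
    (by intro x hx r hr; rw [neg_mul]; exact P.neg_mem (hx r hr))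
    (by intro x y hy r hr; rw [mul_assoc]; exact P.mul_mem_left _ _ (hy r hr))
    (by intro x y hx r hr; rw [mul_assoc]; exact hx _ (J.mul_mem_left _ _ hr))
  have memI : ∀ y, y ∈ I ↔ ∀ z ∈ J, y * z ∈ P := fun y => by simp [I]
  rcases hP.2 I J (fun x hx y hy => (memI x).1 hx y hy) with h' | h'
  · exact Or.inl (h' ((memI a).2 fun y hy => by simpa using (memJ y).1 hy 1))
  · exact Or.inr (h' ((memJ b).2 h))

theorem IsMaximalIdeal.isPrimeIdeal {M : TwoSidedIdeal A} (hM : IsMaximalIdeal M) :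
    IsPrimeIdeal M := by
  refine ⟨hM.1, fun I J h => ?_⟩
  by_contra! h'
  have hI : M ⊔ I = ⊤ := hM.2 _ (left_lt_sup.2 h'.1)
  have hJ : M ⊔ J = ⊤ := hM.2 _ (left_lt_sup.2 h'.2)
  apply hM.1
  rw [eq_top_iff_one_mem] at hI hJ ⊢
  obtain ⟨m, hm, i, hi, h1⟩ := TwoSidedIdeal.mem_sup.1 hI
  obtain ⟨m', hm', j, hj, h2⟩ := TwoSidedIdeal.mem_sup.1 hJ
  have : (1 : A) = m * (m' + j) + i * m' + i * j := by
    calc (1 : A) = (m + i) * (m' + j) := by rw [h1, h2, one_mul]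
      _ = _ := by noncomm_ring
  rw [this]
  exact M.add_mem (M.add_mem (M.mul_mem_right _ _ hm) (M.mul_mem_left _ _ hm')) (h i hi j hj)

/-- An ideal containing the kernel of a surjective homomorphism is a pullback. -/
theorem exists_comap_eq {f : A →+* B} (hf : Function.Surjective f) {I : TwoSidedIdeal A}
    (hI : TwoSidedIdeal.ker f ≤ I) : ∃ K : TwoSidedIdeal B, K.comap f = I := by
  let K : TwoSidedIdeal B := TwoSidedIdeal.mk' (f '' I)
    ⟨0, I.zero_mem, map_zero f⟩
    (by rintro _ _ ⟨x, hx, rfl⟩ ⟨y, hy, rfl⟩; exact ⟨x + y, I.add_mem hx hy, map_add f x y⟩)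
    (by rintro _ ⟨x, hx, rfl⟩; exact ⟨-x, I.neg_mem hx, map_neg f x⟩)
    (by
      rintro b _ ⟨y, hy, rfl⟩
      obtain ⟨x, rfl⟩ := hf b
      exact ⟨x * y, I.mul_mem_left _ _ hy, map_mul f x y⟩)
    (by
      rintro _ b ⟨y, hy, rfl⟩
      obtain ⟨x, rfl⟩ := hf b
      exact ⟨y * x, I.mul_mem_right _ _ hy, map_mul f y x⟩)
  refine ⟨K, ?_⟩
  ext x
  rw [TwoSidedIdeal.mem_comap]
  have : f x ∈ K ↔ ∃ y ∈ I, f y = f x :=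
    TwoSidedIdeal.mem_mk' _ _ _ _ _ _ _
  rw [this]
  constructor
  · rintro ⟨y, hy, hxy⟩
    have : x - y ∈ I := hI ((TwoSidedIdeal.mem_ker f).2 (by rw [map_sub, hxy, sub_self]))
    simpa using I.add_mem this hy
  · exact fun hx => ⟨x, hx, rfl⟩

theorem comap_bot (f : A →+* B) : (⊥ : TwoSidedIdeal B).comap f = TwoSidedIdeal.ker f := by
  ext x
  rw [TwoSidedIdeal.mem_comap, TwoSidedIdeal.mem_ker, TwoSidedIdeal.mem_bot]

theorem comap_eq_top_iff {f : A →+* B} {I : TwoSidedIdeal B} : I.comap f = ⊤ ↔ I = ⊤ := by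
  rw [eq_top_iff_one_mem, eq_top_iff_one_mem, TwoSidedIdeal.mem_comap, map_one]

/-- The kernel of a surjective homomorphism onto a simple ring is maximal. -/
theorem isMaximalIdeal_ker {f : A →+* B} (hf : Function.Surjective f) [IsSimpleRing B] :
    IsMaximalIdeal (TwoSidedIdeal.ker f) := by
  refine ⟨?_, fun I hI => ?_⟩
  · rw [← comap_bot, Ne, comap_eq_top_iff]
    exact bot_ne_top
  · obtain ⟨K, rfl⟩ := exists_comap_eq hf hI.le
    rw [comap_eq_top_iff]
    refine (eq_bot_or_eq_top K).resolve_left ?_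
    rintro rfl
    exact hI.ne (comap_bot f).symm

/-- A left Artinian ring whose zero ideal is prime (elementwise) is simple. -/
theorem isSimpleRing_of_prime [Nontrivial A] [IsArtinianRing A]
    (h : ∀ a b : A, (∀ r, a * r * b = 0) → a = 0 ∨ b = 0) : IsSimpleRing A := by
  have hJ : Ring.jacobson A = ⊥ := by
    by_contra hne
    obtain ⟨a, ha, ha0⟩ := Submodule.exists_mem_ne_zero_of_ne_bot hne
    -- A nonzero a in the radical would keep every power nonzero: primeness gives some a * r * b ≠ 0
    -- one power higher. This contradicts nilpotency.
    have key : ∀ n : ℕ, ∃ b ∈ (Ring.jacobson A) ^ n, b ≠ 0 := by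
      intro n
      induction n with
      | zero => exact ⟨1, by rw [Submodule.pow_zero, Ideal.one_eq_top]; trivial, one_ne_zero⟩
      | succ n ih =>
        obtain ⟨b, hb, hb0⟩ := ih
        by_contra! h'
        refine (h a b fun r => h' _ ?_).elim ha0 hb0
        rw [Ideal.IsTwoSided.pow_succ]
        exact Ideal.mul_mem_mul (Ideal.mul_mem_right _ _ ha) hb
    obtain ⟨n, hn⟩ := IsSemiprimaryRing.isNilpotent (R := A)
    obtain ⟨b, hb, hb0⟩ := key n
    rw [hn] at hb
    exact hb0 (by simpa using hb)
  have : IsSemisimpleRing A := IsArtinianRing.isSemisimpleRing_iff_jacobson.2 hJ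
  refine IsSimpleRing.of_eq_bot_or_eq_top fun I => or_iff_not_imp_left.2 fun hI => ?_
  obtain ⟨i, hi, hi0⟩ := exists_mem_ne_zero hI
  -- A complementary left ideal L satisfies iAL ⊆ I ∩ L = 0, so primeness kills it.
  obtain ⟨L, hL⟩ := exists_isCompl I.asIdeal
  have hLbot : L = ⊥ := by
    rw [eq_bot_iff]
    intro l hl
    refine (h i l fun r => ?_).resolve_left hi0
    have h1 : i * r * l ∈ I.asIdeal ⊓ L :=
      ⟨TwoSidedIdeal.mem_asIdeal.2 (I.mul_mem_right _ _ (I.mul_mem_right _ _ hi)),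
        L.mul_mem_left _ hl⟩
    rw [hL.inf_eq_bot] at h1
    simpa using h1
  have h1 := hL.sup_eq_top
  rw [hLbot, sup_bot_eq] at h1
  rw [eq_top_iff_one_mem, ← TwoSidedIdeal.mem_asIdeal, h1]
  trivial

theorem mem_iff_mk'_eq_zero (I : TwoSidedIdeal A) (x : A) : x ∈ I ↔ I.ringCon.mk' x = 0 := by
  conv_lhs => rw [← TwoSidedIdeal.ker_ringCon_mk' I]
  rw [TwoSidedIdeal.mem_ker]

theorem mk'_surjective (I : TwoSidedIdeal A) : Function.Surjective I.ringCon.mk' :=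
  Quotient.mk''_surjective

theorem nontrivial_quotient {I : TwoSidedIdeal A} (h : I ≠ ⊤) :
    Nontrivial I.ringCon.Quotient := by
  refine ⟨1, 0, fun h1 => h ?_⟩
  rw [eq_top_iff_one_mem, mem_iff_mk'_eq_zero, map_one, h1]

end Ideals

/-! ### Maximal subrings: supplementing ideals and primeness. -/

section Subrings

variable {T : Type u} [Ring T] {R : Subring T}

theorem IsMaximalSubring.eq_top_or_le (h : IsMaximalSubring R) {B : Subring T} (hB : R ≤ B) :
    B = ⊤ ∨ B ≤ R := by
  rcases hB.lt_or_eq with h' | h'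
  · exact Or.inl (h.2 B h')
  · exact Or.inr h'.ge

/-- An ideal not contained in a maximal subring supplements it. -/
theorem IsMaximalSubring.exists_sub_mem (h : IsMaximalSubring R) {N : TwoSidedIdeal T}
    (hN : ¬ (N : Set T) ⊆ R) (t : T) : ∃ r ∈ R, t - r ∈ N := by
  let B : Subring T := (R.map N.ringCon.mk').comap N.ringCon.mk'
  have memB : ∀ x, x ∈ B ↔ ∃ r ∈ R, x - r ∈ N := by
    intro x
    simp only [B, Subring.mem_comap, Subring.mem_map]
    refine exists_congr fun r => and_congr_right fun _ => ?_
    rw [mem_iff_mk'_eq_zero, map_sub, sub_eq_zero, eq_comm]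
  have hRB : R ≤ B := fun x hx => (memB x).2 ⟨x, hx, by simp⟩
  rcases h.eq_top_or_le hRB with h' | h'
  · exact (memB t).1 (h' ▸ Subring.mem_top t)
  · exact (hN fun x hx => h' ((memB x).2 ⟨0, R.zero_mem, by simpa using hx⟩)).elim

theorem mem_conductor {x : T} : x ∈ conductor R ↔ ∀ a b : T, a * x * b ∈ R := by
  simp [conductor]

theorem conductor_subset : (conductor R : Set T) ⊆ R := fun _ hx => by
  simpa using mem_conductor.1 hx 1 1

theorem le_conductor_iff {N : TwoSidedIdeal T} : N ≤ conductor R ↔ (N : Set T) ⊆ R :=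
  ⟨fun h => Set.Subset.trans h conductor_subset, fun h _ hx => mem_conductor.2 fun _ _ =>
    h (N.mul_mem_right _ _ (N.mul_mem_left _ _ hx))⟩

/-- A maximal subring with vanishing left conductor is a prime ring. -/
theorem IsMaximalSubring.prime_of_leftConductor (h : IsMaximalSubring R)
    (hl : ∀ x : T, (∀ t, t * x ∈ R) → x = 0) (a b : R) (hab : ∀ r, a * r * b = 0) :
    a = 0 ∨ b = 0 := by
  -- `J` is the right annihilator of aR in R, and its idealizer `B` contains R. If B = T, then Tb ⊆
  -- J ⊆ R. If B ⊆ R, then aJ = 0 gives Ta ⊆ B ⊆ R.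
  let J : Set T := {y | y ∈ R ∧ ∀ r ∈ R, (a : T) * r * y = 0}
  have hab' : (b : T) ∈ J :=
    ⟨b.2, fun r hr => by simpa using congrArg Subtype.val (hab ⟨r, hr⟩)⟩
  let B : Subring T :=
    { carrier := {x | ∀ y ∈ J, x * y ∈ J}
      mul_mem' := fun {x z} hx hz y hy => by rw [mul_assoc]; exact hx _ (hz _ hy)
      one_mem' := fun y hy => by rwa [one_mul]
      add_mem' := fun {x z} hx hz y hy => by
        rw [add_mul]
        refine ⟨R.add_mem (hx y hy).1 (hz y hy).1, fun r hr => ?_⟩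
        rw [mul_add, (hx y hy).2 r hr, (hz y hy).2 r hr, add_zero]
      zero_mem' := fun y hy => by
        rw [zero_mul]
        exact ⟨R.zero_mem, fun r _ => mul_zero _⟩
      neg_mem' := fun {x} hx y hy => by
        rw [neg_mul]
        refine ⟨R.neg_mem (hx y hy).1, fun r hr => ?_⟩
        rw [mul_neg, (hx y hy).2 r hr, neg_zero] }
  have hRB : R ≤ B := fun x hx y hy => ⟨R.mul_mem hx hy.1, fun r hr => by
    rw [← mul_assoc, mul_assoc (a : T)]
    exact hy.2 _ (R.mul_mem hr hx)⟩
  rcases h.eq_top_or_le hRB with h' | h'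
  · right
    refine Subtype.ext (hl _ fun t => ?_)
    have : t ∈ B := h' ▸ Subring.mem_top t
    exact (this _ hab').1
  · left
    refine Subtype.ext (hl _ fun t => h' fun y hy => ?_)
    have : t * a * y = 0 := by
      have := hy.2 1 R.one_mem
      rw [mul_one] at this
      rw [mul_assoc, this, mul_zero]
    rw [this]
    exact ⟨R.zero_mem, fun r _ => mul_zero _⟩

end Subrings

/-! ### Matrix units and their centralizer. -/

section MatrixUnits

open Matrix

variable {T D : Type u} [Ring T] [Ring D] {n : ℕ}

/-- The image of the matrix unit `E i j`. -/
def unitImage (f : Matrix (Fin n) (Fin n) D →+* T) (i j : Fin n) : T := f (single i j 1)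

theorem unitImage_mul (f : Matrix (Fin n) (Fin n) D →+* T) (i j k l : Fin n) :
    unitImage f i j * unitImage f k l = if j = k then unitImage f i l else 0 := by
  unfold unitImage
  rw [← map_mul]
  split_ifs with h
  · subst h
    rw [single_mul_single_same, one_mul]
  · rw [single_mul_single_of_ne _ _ _ _ h, map_zero]

theorem unitImage_mul_assoc (f : Matrix (Fin n) (Fin n) D →+* T) (i j k l : Fin n) (t : T) :
    unitImage f i j * (unitImage f k l * t) = if j = k then unitImage f i l * t else 0 := by
  rw [← mul_assoc, unitImage_mul]
  split_ifs <;> simp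

theorem sum_unitImage (f : Matrix (Fin n) (Fin n) D →+* T) : ∑ i, unitImage f i i = 1 := by
  unfold unitImage
  rw [← map_sum, sum_single_one, map_one]

/-- The centralizer of the matrix units. -/
def unitCentralizer (f : Matrix (Fin n) (Fin n) D →+* T) : Subring T :=
  Subring.centralizer (Set.range fun p : Fin n × Fin n => unitImage f p.1 p.2)

theorem mem_unitCentralizer {f : Matrix (Fin n) (Fin n) D →+* T} {t : T} :
    t ∈ unitCentralizer f ↔ ∀ i j, unitImage f i j * t = t * unitImage f i j := by
  simp only [unitCentralizer, Subring.mem_centralizer_iff, Set.forall_mem_range, Prod.forall]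

/-- The coefficient of an element at the position `i j`. -/
def unitCoeff (f : Matrix (Fin n) (Fin n) D →+* T) (t : T) (i j : Fin n) : T :=
  ∑ k, unitImage f k i * t * unitImage f j k

theorem unitImage_mul_coeff (f : Matrix (Fin n) (Fin n) D →+* T) (t : T) (i j a b : Fin n) :
    unitImage f a b * unitCoeff f t i j = unitImage f a i * t * unitImage f j b := by
  simp [unitCoeff, Finset.mul_sum, mul_assoc, unitImage_mul_assoc]

theorem coeff_mul_unitImage (f : Matrix (Fin n) (Fin n) D →+* T) (t : T) (i j a b : Fin n) :
    unitCoeff f t i j * unitImage f a b = unitImage f a i * t * unitImage f j b := by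
  simp [unitCoeff, Finset.sum_mul, mul_assoc, unitImage_mul]

theorem unitCoeff_mem (f : Matrix (Fin n) (Fin n) D →+* T) (t : T) (i j : Fin n) :
    unitCoeff f t i j ∈ unitCentralizer f :=
  mem_unitCentralizer.2 fun a b => by rw [unitImage_mul_coeff, coeff_mul_unitImage]

theorem sum_coeff_mul_unitImage (f : Matrix (Fin n) (Fin n) D →+* T) (t : T) :
    ∑ i, ∑ j, unitCoeff f t i j * unitImage f i j = t := by
  simp_rw [coeff_mul_unitImage, ← Finset.mul_sum, sum_unitImage, mul_one, ← Finset.sum_mul,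
    sum_unitImage, one_mul]

/-- A ring containing the `n × n` matrix units is a full matrix ring over their centralizer. -/
def unitEquiv (f : Matrix (Fin n) (Fin n) D →+* T) :
    T ≃+* Matrix (Fin n) (Fin n) (unitCentralizer f) where
  toFun t := of fun i j => ⟨unitCoeff f t i j, unitCoeff_mem f t i j⟩
  invFun M := ∑ i, ∑ j, (M i j : T) * unitImage f i j
  left_inv t := sum_coeff_mul_unitImage f t
  right_inv M := by
    ext i j
    have hM : ∀ a b k l, unitImage f k l * (M a b : T) = M a b * unitImage f k l :=
      fun a b => mem_unitCentralizer.1 (M a b).2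
    simp only [of_apply, unitCoeff, Finset.mul_sum, Finset.sum_mul]
    have : ∀ k a b, unitImage f k i * ((M a b : T) * unitImage f a b) * unitImage f j k =
        if b = j then (if i = a then M a b * unitImage f k k else 0) else 0 := by
      intro k a b
      rw [← mul_assoc, hM, mul_assoc, mul_assoc, unitImage_mul]
      split_ifs with h1 h2 <;> simp [unitImage_mul, *]
    simp_rw [this]
    simp [← Finset.mul_sum, sum_unitImage]
  map_mul' s t := by
    ext i j
    simp only [of_apply, mul_apply, Subring.coe_mul, AddSubmonoidClass.coe_finsetSum]
    have : ∀ m, unitCoeff f s i m * unitCoeff f t m j =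
        ∑ k, unitImage f k i * s * (unitImage f m m * (t * unitImage f j k)) := by
      intro m
      rw [unitCoeff, Finset.sum_mul]
      refine Finset.sum_congr rfl fun k _ => ?_
      rw [mul_assoc (_ * s), unitImage_mul_coeff, mul_assoc (unitImage f m m)]
    simp_rw [this]
    rw [Finset.sum_comm, unitCoeff]
    refine Finset.sum_congr rfl fun k _ => ?_
    rw [← Finset.mul_sum, ← Finset.sum_mul, sum_unitImage, one_mul]
    simp only [mul_assoc]
  map_add' s t := by
    ext i j
    simp [unitCoeff, mul_add, add_mul, Finset.sum_add_distrib]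

/-- Scalar matrices commute with the matrix units. -/
def unitScalar (f : Matrix (Fin n) (Fin n) D →+* T) : D →+* unitCentralizer f :=
  (f.comp (Matrix.scalar (Fin n))).codRestrict (unitCentralizer f) fun d =>
    mem_unitCentralizer.2 fun i j => by
      simp only [unitImage, RingHom.comp_apply, ← map_mul]
      congr 1
      ext a b
      simp [Matrix.single, Matrix.diagonal_mul, Matrix.mul_diagonal]

/-- This identifies the image of f inside the new matrix ring: the matrices with entries in the
range of `unitScalar f`. -/
theorem unitEquiv_apply_map (f : Matrix (Fin n) (Fin n) D →+* T) (m : Matrix (Fin n) (Fin n) D) :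
    unitEquiv f (f m) = m.map (unitScalar f) := by
  ext i j
  change unitCoeff f (f m) i j = f (Matrix.scalar (Fin n) (m i j))
  simp only [unitCoeff, unitImage, ← map_mul, ← map_sum]
  congr 1
  have : ∀ k, single k i (1 : D) * m * single j k 1 = single k k (m i j) := by
    intro k
    rw [single_mul_mul_single]
    simp
  simp_rw [this]
  ext a b
  by_cases hab : a = b
  · subst hab
    simp [Matrix.sum_apply, single]
  · have : ∀ c : Fin n, ¬ (c = a ∧ c = b) := fun c hc => hab (hc.1.symm.trans hc.2)
    simp [Matrix.sum_apply, single, hab, this]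

end MatrixUnits

/-! ### Reduction to a maximal subring that is a division ring. -/

section Subrings

variable {T : Type u} [Ring T] {R : Subring T}

/-- A maximal subring with a simple left Artinian underlying ring: the big ring is a matrix ring
over a ring with a maximal subring that is a division ring. -/
theorem IsMaximalSubring.exists_matrix (h : IsMaximalSubring R) [IsSimpleRing R]
    [IsArtinianRing R] :
    ∃ (n : ℕ) (S : Type u) (_ : Ring S), 0 < n ∧ Nonempty (T ≃+* Matrix (Fin n) (Fin n) S) ∧
      ∃ D : Subring S, IsMaximalSubring D ∧ IsDivisionRing D := by
  obtain ⟨n, hn, D₀, _, ⟨φ⟩⟩ := IsSimpleRing.exists_ringEquiv_matrix_divisionRing R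
  let f : Matrix (Fin n) (Fin n) D₀ →+* T := R.subtype.comp φ.symm.toRingHom
  have hf : ∀ r : R, f (φ r) = r := fun r => by simp [f]
  have hfR : ∀ m, f m ∈ R := fun m => (φ.symm m).2
  let e := unitEquiv f
  let D : Subring (unitCentralizer f) := (unitScalar f).range
  have hRD : ∀ t : T, t ∈ R ↔ e t ∈ D.matrix := by
    intro t
    constructor
    · intro ht i j
      have h1 := unitEquiv_apply_map f (φ ⟨t, ht⟩)
      rw [hf] at h1
      exact ⟨φ ⟨t, ht⟩ i j, by simp [e, h1]⟩
    · intro ht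
      choose m hm using ht
      have h1 : e t = e (f (Matrix.of m)) := by
        rw [show e (f (Matrix.of m)) = _ from unitEquiv_apply_map f (Matrix.of m)]
        ext i j
        simp [hm]
      rw [e.injective h1]
      exact hfR _
  have : Nontrivial T := R.subtype_injective.nontrivial
  have hnt : Nontrivial (unitCentralizer f) := by
    infer_instance
  refine ⟨n, unitCentralizer f, inferInstance, Nat.pos_of_ne_zero hn.ne, ⟨e⟩, D, ⟨?_, ?_⟩, ?_, ?_⟩
  · intro htop
    refine h.1 ((Subring.eq_top_iff' R).2 fun t => (hRD t).2 fun i j => ?_)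
    rw [htop]
    trivial
  · intro B hB
    -- Matrices over B form a subring above R, so maximality of R decides; scalar matrices then
    -- translate the answer back to B.
    have hle : R ≤ B.matrix.comap e.toRingHom := fun t ht i j => hB.le ((hRD t).1 ht i j)
    rcases h.eq_top_or_le hle with h' | h'
    · refine (Subring.eq_top_iff' B).2 fun b => ?_
      have h1 : e.symm (Matrix.scalar (Fin n) b) ∈ B.matrix.comap e.toRingHom := by
        rw [h']; trivial
      have h2 : Matrix.scalar (Fin n) b ∈ B.matrix := by simpa using! h1
      simpa using h2 0 0
    · refine (hB.not_ge fun b hb => ?_).elim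
      have h1 : e.symm (Matrix.scalar (Fin n) b) ∈ B.matrix.comap e.toRingHom := by
        have : Matrix.scalar (Fin n) b ∈ B.matrix := fun i j => by
          rw [Matrix.scalar_apply, Matrix.diagonal_apply]
          split_ifs
          · exact hb
          · exact B.zero_mem
        simpa using! this
      have h2 := (hRD _).1 (h' h1)
      rw [RingEquiv.apply_symm_apply] at h2
      simpa using h2 0 0
  · infer_instance
  · rintro ⟨_, d, rfl⟩ hd
    have hd0 : d ≠ 0 := by
      rintro rfl
      exact hd (Subtype.ext (map_zero _))
    exact (IsUnit.mk0 d hd0).map (unitScalar f).rangeRestrict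

end Subrings

/-! ### Ideals of a ring with a maximal division subring. -/

section DivisionSubring

variable {S : Type u} [Ring S] {D : Subring S}

theorem IsDivisionRing.eq_zero_of_mem (hD : IsDivisionRing D) {I : TwoSidedIdeal S}
    (hI : I ≠ ⊤) {d : S} (hd : d ∈ D) (hdI : d ∈ I) : d = 0 := by
  by_contra h0
  obtain ⟨u, hu⟩ := hD.2 ⟨d, hd⟩ fun h => h0 (congrArg Subtype.val h)
  have h1 : ((u⁻¹ : Dˣ) : D) * u = 1 := u.inv_mul
  rw [hu] at h1
  have h2 : (((u⁻¹ : Dˣ) : D) : S) * d = 1 := congrArg Subtype.val h1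
  exact hI (eq_top_iff_one_mem.2 (h2 ▸ I.mul_mem_left _ _ hdI))

/-- Supplies the hypothesis of `exists_sub_mem`, whence S = D + I. -/
theorem IsDivisionRing.not_subset (hD : IsDivisionRing D) {I : TwoSidedIdeal S} (hI : I ≠ ⊤)
    (hI0 : I ≠ ⊥) : ¬ (I : Set S) ⊆ D := fun h =>
  hI0 (eq_bot_iff_forall.2 fun _ hx => hD.eq_zero_of_mem hI (h hx) hx)

/-- Nonzero proper ideals are maximal as left ideals. -/
theorem IsMaximalSubring.isMaximal_asIdeal (h : IsMaximalSubring D) (hD : IsDivisionRing D)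
    {I : TwoSidedIdeal S} (hI : I ≠ ⊤) (hI0 : I ≠ ⊥) : I.asIdeal.IsMaximal := by
  refine Ideal.isMaximal_def.2 ⟨fun h1 => hI ?_, fun L hL => ?_⟩
  · rw [eq_top_iff_one_mem, ← TwoSidedIdeal.mem_asIdeal, h1]
    trivial
  · obtain ⟨x, hxL, hxI⟩ := SetLike.exists_of_lt hL
    -- Modulo I, x is congruent to some d ∈ D. This d lies in L and is nonzero as x ∉ I, so L
    -- contains a unit.
    obtain ⟨d, hd, hxd⟩ := h.exists_sub_mem (hD.not_subset hI hI0) x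
    have hdL : d ∈ L := by
      have := L.sub_mem hxL (hL.le (TwoSidedIdeal.mem_asIdeal.2 hxd))
      simpa using this
    have hd0 : (⟨d, hd⟩ : D) ≠ 0 := by
      intro h0
      have : d = 0 := congrArg Subtype.val h0
      rw [this, sub_zero] at hxd
      exact hxI hxd
    obtain ⟨u, hu⟩ := hD.2 _ hd0
    have h1 : ((u⁻¹ : Dˣ) : D) * u = 1 := u.inv_mul
    rw [hu] at h1
    have h2 : (((u⁻¹ : Dˣ) : D) : S) * d = 1 := congrArg Subtype.val h1
    exact (Ideal.eq_top_iff_one L).2 (h2 ▸ L.mul_mem_left _ hdL)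

/-- Both are maximal left ideals, so nonzero proper ideals form an antichain. -/
theorem IsMaximalSubring.eq_of_le (h : IsMaximalSubring D) (hD : IsDivisionRing D)
    {I J : TwoSidedIdeal S} (hI : I ≠ ⊤) (hI0 : I ≠ ⊥) (hJ : J ≠ ⊤) (hIJ : I ≤ J) : I = J := by
  have hJ0 : J ≠ ⊥ := fun h0 => hI0 (le_bot_iff.1 (h0 ▸ hIJ))
  have h1 := (h.isMaximal_asIdeal hD hI hI0).eq_of_le (h.isMaximal_asIdeal hD hJ hJ0).ne_top
    (TwoSidedIdeal.asIdeal.monotone hIJ)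
  ext x
  rw [← TwoSidedIdeal.mem_asIdeal, h1, TwoSidedIdeal.mem_asIdeal]

/-- With two distinct nonzero proper ideals, the ring is left Artinian. -/
theorem IsMaximalSubring.isArtinianRing_of_not_atMostOneIdeal (h : IsMaximalSubring D)
    (hD : IsDivisionRing D) (hS : ¬ AtMostOneIdeal S) : IsArtinianRing S := by
  simp only [AtMostOneIdeal, not_forall] at hS
  obtain ⟨I, J, hI0, hI, hJ0, hJ, hIJ⟩ := hS
  have hbot : I ⊓ J = ⊥ := by
    by_contra h0
    have h1 : I ⊓ J ≠ ⊤ := fun h1 => hI (top_le_iff.1 (h1 ▸ inf_le_left))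
    exact hIJ ((h.eq_of_le hD h1 h0 hI inf_le_left).symm.trans
      (h.eq_of_le hD h1 h0 hJ inf_le_right))
  have := h.isMaximal_asIdeal hD hI hI0
  have := h.isMaximal_asIdeal hD hJ hJ0
  have : IsSimpleModule S (S ⧸ I.asIdeal) :=
    isSimpleModule_iff_isCoatom.2 (h.isMaximal_asIdeal hD hI hI0).out
  have : IsSimpleModule S (S ⧸ J.asIdeal) :=
    isSimpleModule_iff_isCoatom.2 (h.isMaximal_asIdeal hD hJ hJ0).out
  refine isArtinian_of_injective (I.asIdeal.mkQ.prod J.asIdeal.mkQ)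
    (LinearMap.ker_eq_bot.1 (le_bot_iff.1 fun x hx => ?_))
  rw [LinearMap.ker_prod, Submodule.ker_mkQ, Submodule.ker_mkQ] at hx
  have : x ∈ I ⊓ J := (TwoSidedIdeal.mem_inf S).2 ⟨hx.1, hx.2⟩
  rw [hbot] at this
  exact (TwoSidedIdeal.mem_bot S).1 this

end DivisionSubring

/-! ### Jacobson radical and primitivity. -/

section Jacobson

variable {A : Type u} [Ring A]

theorem mem_jacobson_iff_left {x : A} :
    x ∈ Ring.jacobson A ↔ ∀ y : A, ∃ z, z * (1 + y * x) = 1 := by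
  rw [← Ideal.jacobson_bot, Ideal.mem_jacobson_iff]
  refine forall_congr' fun y => exists_congr fun z => ?_
  rw [Ideal.mem_bot, sub_eq_zero, mul_add, mul_one, ← mul_assoc, add_comm]

/-- A one-sided quasi-regular ideal is quasi-regular; hence left-right symmetry. -/
theorem asIdeal_le_jacobson_of_op {M : TwoSidedIdeal A}
    (h : M.op.asIdeal ≤ Ring.jacobson Aᵐᵒᵖ) : M.asIdeal ≤ Ring.jacobson A := by
  have key : ∀ x ∈ M, ∃ z, (1 + x) * z = 1 := by
    intro x hx
    obtain ⟨z, hz⟩ := mem_jacobson_iff_left.1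
      (h (TwoSidedIdeal.mem_asIdeal.2 (TwoSidedIdeal.mem_op_iff.2 hx :
        MulOpposite.op x ∈ M.op))) 1
    refine ⟨z.unop, ?_⟩
    simpa using congrArg MulOpposite.unop hz
  intro x hx
  refine mem_jacobson_iff_left.2 fun y => ?_
  have hyx : y * x ∈ M := M.mul_mem_left _ _ hx
  obtain ⟨z, hz⟩ := key _ hyx
  -- The right inverse z of 1 + yx again lies in 1 + M, so it has a right inverse too, which must be
  -- 1 + yx; hence z is also a left inverse.
  have hz' : z - 1 ∈ M := by
    have : z - 1 = -(y * x * z) := by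
      have : z - 1 = (1 + y * x) * z - 1 - y * x * z := by noncomm_ring
      rw [this, hz]
      simp
    rw [this]
    exact M.neg_mem (M.mul_mem_right _ _ hyx)
  obtain ⟨w, hw⟩ := key _ hz'
  rw [add_sub_cancel] at hw
  have : 1 + y * x = w := left_inv_eq_right_inv hz hw
  exact ⟨z, by rw [this, hw]⟩

/-- If every nonzero ideal contains `M` and `M` is not in the Jacobson radical, then the ring is
left primitive. -/
theorem isLeftPrimitive_of_not_le_jacobson {M : TwoSidedIdeal A}
    (hM : ∀ I : TwoSidedIdeal A, I ≠ ⊥ → M ≤ I) (h : ¬ M.asIdeal ≤ Ring.jacobson A) :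
    IsLeftPrimitive A := by
  rw [Ring.jacobson_eq_sInf_isMaximal, le_sInf_iff] at h
  push Not at h
  obtain ⟨L, hL, hML⟩ := h
  refine ⟨A ⧸ L, inferInstance, inferInstance, isSimpleModule_iff_isCoatom.2 hL.out.out, ?_⟩
  rw [← Module.annihilator_eq_bot]
  -- A nonzero annihilator of A/L would contain M, and acting on the class of 1 would put M inside
  -- L.
  by_contra h0
  refine hML ?_
  have h1 := hM (Module.annihilator A (A ⧸ L)).toTwoSided fun h1 => h0 (by
    rw [← Ideal.asIdeal_toTwoSided (Module.annihilator A (A ⧸ L)), h1,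
      TwoSidedIdeal.bot_asIdeal])
  intro x hx
  have h2 : x ∈ Module.annihilator A (A ⧸ L) := Ideal.mem_toTwoSided.1 (h1 hx)
  have h3 := Module.mem_annihilator.1 h2 (Submodule.Quotient.mk 1)
  rw [← Submodule.Quotient.mk_smul, Submodule.Quotient.mk_eq_zero, smul_eq_mul, mul_one] at h3
  exact h3

end Jacobson

/-! ### Rings with at most one nonzero proper ideal. -/

section Trichotomy

variable {S : Type u} [Ring S] {D : Subring S}

theorem isUniqueIdeal_of_atMostOneIdeal (hS : AtMostOneIdeal S) {M : TwoSidedIdeal S}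
    (h0 : M ≠ ⊥) (h1 : M ≠ ⊤) : IsUniqueIdeal M :=
  ⟨h0, h1, fun I hI hI' => hS I M hI hI' h0 h1⟩

theorem IsUniqueIdeal.le_of_ne_bot {M : TwoSidedIdeal S} (hM : IsUniqueIdeal M)
    {I : TwoSidedIdeal S} (hI : I ≠ ⊥) : M ≤ I := by
  by_cases h : I = ⊤
  · exact h ▸ le_top
  · exact (hM.2.2 I hI h).ge

theorem IsUniqueIdeal.asIdeal_le {M : TwoSidedIdeal S} (hM : IsUniqueIdeal M)
    {I : Ideal S} [I.IsTwoSided] (hI : I ≠ ⊥) : M.asIdeal ≤ I := by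
  have := hM.le_of_ne_bot (I := I.toTwoSided) fun h1 => hI (by
    rw [← Ideal.asIdeal_toTwoSided I, h1, TwoSidedIdeal.bot_asIdeal])
  exact fun x hx => Ideal.mem_toTwoSided.1 (this hx)

/-- A ring with at most one nonzero proper ideal and a maximal subring that is a division ring is
simple, or has square-zero radical, or has an idempotent ideal that is the radical, or is
primitive. -/
theorem IsMaximalSubring.trichotomy (h : IsMaximalSubring D) (hD : IsDivisionRing D)
    (hS : AtMostOneIdeal S) :
    IsSimpleRing S ∨
    (∃ M : TwoSidedIdeal S, IsUniqueIdeal M ∧ M.asIdeal * M.asIdeal = ⊥ ∧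
      Ring.jacobson S = M.asIdeal) ∨
    (∃ M : TwoSidedIdeal S, IsUniqueIdeal M ∧ M.asIdeal * M.asIdeal = M.asIdeal ∧
      ((IsLeftPrimitive S ∧ IsRightPrimitive S) ∨ Ring.jacobson S = M.asIdeal)) := by
  have hnt : Nontrivial S := by
    have := hD.1
    exact D.subtype_injective.nontrivial
  by_cases hs : ∀ I : TwoSidedIdeal S, I = ⊥ ∨ I = ⊤
  · exact Or.inl (IsSimpleRing.of_eq_bot_or_eq_top hs)
  right
  push Not at hs
  obtain ⟨M, h0, h1⟩ := hs
  have hM := isUniqueIdeal_of_atMostOneIdeal hS h0 h1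
  have hmax := h.isMaximal_asIdeal hD h1 h0
  have hJ : Ring.jacobson S ≤ M.asIdeal := Ring.jacobson_le_of_isMaximal _
  by_cases hsq : M.asIdeal * M.asIdeal = ⊥
  · refine Or.inl ⟨M, hM, hsq, le_antisymm hJ fun x hx => mem_jacobson_iff_left.2 fun y => ?_⟩
    refine ⟨1 - y * x, ?_⟩
    have h2 : y * x * (y * x) = 0 := by
      rw [← Ideal.mem_bot, ← hsq]
      exact Ideal.mul_mem_mul (Ideal.mul_mem_left _ _ hx) (Ideal.mul_mem_left _ _ hx)
    have h3 : (1 - y * x) * (1 + y * x) = 1 - y * x * (y * x) := by noncomm_ring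
    rw [h3, h2, sub_zero]
  · refine Or.inr ⟨M, hM, le_antisymm Ideal.mul_le_left (hM.asIdeal_le hsq), ?_⟩
    by_cases hle : M.asIdeal ≤ Ring.jacobson S
    · exact Or.inr (le_antisymm hJ hle)
    -- M is the least nonzero ideal in the opposite ring as well, and membership in the radical is
    -- left-right symmetric, so the same criterion gives right primitivity.
    · refine Or.inl ⟨isLeftPrimitive_of_not_le_jacobson (fun I hI => hM.le_of_ne_bot hI) hle,
        isLeftPrimitive_of_not_le_jacobson (M := M.op) (fun I hI => ?_)
          fun h' => hle (asIdeal_le_jacobson_of_op h')⟩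
      have h2 : I.unop ≠ ⊥ := by
        intro h2
        refine hI (eq_bot_iff_forall.2 fun x hx => ?_)
        have : x.unop ∈ I.unop := TwoSidedIdeal.mem_unop_iff.2 hx
        rw [h2, TwoSidedIdeal.mem_bot] at this
        exact MulOpposite.unop_injective this
      intro x hx
      exact TwoSidedIdeal.mem_unop_iff.1 (hM.le_of_ne_bot h2 (TwoSidedIdeal.mem_op_iff.1 hx))

end Trichotomy

/-! ### Lifting the Artinian property and comparing radicals. -/

section ArtinianJacobson

variable {T : Type u} [Ring T] {R : Subring T}

/-- If an ideal contained in the left Artinian subring `R` has left Artinian quotient, then the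
big ring is left Artinian. -/
theorem isArtinianRing_of_quotient [IsArtinianRing R] {C : TwoSidedIdeal T}
    (hC : (C : Set T) ⊆ R) [IsArtinianRing C.ringCon.Quotient] : IsArtinianRing T := by
  have h1 : IsArtinian T C.asIdeal := by
    refine isArtinian_of_tower R ?_
    let g : C.asIdeal →ₗ[R] R :=
      { toFun := fun x => ⟨x, hC x.2⟩
        map_add' := fun _ _ => rfl
        map_smul' := fun _ _ => rfl }
    exact isArtinian_of_injective g fun x y hxy =>
      Subtype.ext (congrArg (Subtype.val : R → T) hxy)
  let π : T →ₛₗ[C.ringCon.mk'] C.ringCon.Quotient := C.ringCon.mk'.toSemilinearMap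
  have hπ : Function.Surjective π := mk'_surjective C
  have : RingHomSurjective C.ringCon.mk' := ⟨mk'_surjective C⟩
  have hker : LinearMap.ker π = C.asIdeal := by
    ext x
    rw [LinearMap.mem_ker, TwoSidedIdeal.mem_asIdeal, mem_iff_mk'_eq_zero]
    rfl
  -- T-submodules of T/C inject, preserving strict inclusion, into the left ideals of the quotient
  -- ring.
  have h2 : IsArtinian T (T ⧸ C.asIdeal) := by
    let q : (T ⧸ C.asIdeal) →ₛₗ[C.ringCon.mk'] C.ringCon.Quotient :=
      C.asIdeal.liftQ π hker.ge
    have hq : Function.Injective q := LinearMap.ker_eq_bot.1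
      (Submodule.ker_liftQ_eq_bot _ _ _ hker.le)
    exact ⟨Subrelation.wf
      (fun {A B} hAB => show A.map q < B.map q from Submodule.map_strictMono_of_injective hq hAB)
      (InvImage.wf (Submodule.map q) IsWellFounded.wf)⟩
  exact (isArtinian_iff_submodule_quotient C.asIdeal).2 ⟨h1, h2⟩

theorem pow_mem_ideal_pow {A : Type u} [Ring A] {J : Ideal A} [J.IsTwoSided] {x : A} (hx : x ∈ J)
    (n : ℕ) : x ^ n ∈ J ^ n := by
  induction n with
  | zero => rw [Submodule.pow_zero, Ideal.one_eq_top]; trivial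
  | succ n ih =>
    rw [Ideal.IsTwoSided.pow_succ, pow_succ']
    exact Ideal.mul_mem_mul hx ih

/-- J(T) is nilpotent, so its contraction is a nil ideal of R. -/
theorem comap_jacobson_le [IsArtinianRing T] :
    (Ring.jacobson T).comap R.subtype ≤ Ring.jacobson R := by
  intro x hx
  refine mem_jacobson_iff_left.2 fun y => ?_
  obtain ⟨n, hn⟩ := IsSemiprimaryRing.isNilpotent (R := T)
  have hnil : IsNilpotent (y * x) := by
    refine ⟨n, Subtype.ext ?_⟩
    have h1 : ((y : T) * x) ^ n ∈ Ring.jacobson T ^ n :=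
      pow_mem_ideal_pow (Ideal.mul_mem_left (Ring.jacobson T) _ hx) n
    rw [hn] at h1
    simpa using h1
  obtain ⟨u, hu⟩ := hnil.isUnit_one_add
  exact ⟨(u⁻¹ : Rˣ), by rw [← hu, Units.inv_mul]⟩

/-- For y in T only yxy ∈ C is known to lie in R. So x·yxy ∈ J(R), and 1 − (xy)² = (1 − xy)(1 + xy)
is left invertible. If u is the resulting left inverse of 1 + xy, then 1 − yux is one of 1 + yx. -/
theorem jacobson_le_comap {C : TwoSidedIdeal T} (hC : (C : Set T) ⊆ R)
    (hJ : ∀ x ∈ Ring.jacobson R, (x : T) ∈ C) :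
    Ring.jacobson R ≤ (Ring.jacobson T).comap R.subtype := by
  intro x hx
  refine mem_jacobson_iff_left.2 fun y => ?_
  change ∃ z, z * (1 + y * (x : T)) = 1
  have hxC := hJ x hx
  let c : R := ⟨y * x * y, hC (C.mul_mem_right _ _ (C.mul_mem_left _ _ hxC))⟩
  obtain ⟨w, hw⟩ := mem_jacobson_iff_left.1 (Ideal.mul_mem_right c _ hx) (-1)
  have hw' : (w : T) * (1 - x * y * (x * y)) = 1 := by
    have := congrArg (Subtype.val : R → T) hw
    simp only [Subring.coe_mul, Subring.coe_add, Subring.coe_one, Subring.coe_neg, c] at this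
    refine Eq.trans ?_ this
    noncomm_ring
  have hu : (w : T) * (1 - x * y) * (1 + x * y) = 1 := by
    refine Eq.trans ?_ hw'
    noncomm_ring
  generalize (w : T) * (1 - x * y) = u at hu
  refine ⟨1 - y * u * x, ?_⟩
  have : (1 - y * u * x) * (1 + y * (x : T)) = 1 + y * x - y * (u * (1 + x * y)) * x := by
    noncomm_ring
  rw [this, hu, mul_one, add_sub_cancel_right]

end ArtinianJacobson

/-! ### The quotient by the conductor, and primes not contained in R. -/

section Conductor

variable {T : Type u} [Ring T] (R : Subring T)

/-- The homomorphism from a subring to the quotient by an ideal. -/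
def toQuotient (N : TwoSidedIdeal T) : R →+* N.ringCon.Quotient :=
  N.ringCon.mk'.comp R.subtype

theorem ker_toQuotient (N : TwoSidedIdeal T) :
    TwoSidedIdeal.ker (toQuotient R N) = contract R N := by
  ext x
  rw [TwoSidedIdeal.mem_ker, contract, TwoSidedIdeal.mem_comap, mem_iff_mk'_eq_zero]
  rfl

variable {R}

theorem mk'_mem_range_iff {t : T} :
    (conductor R).ringCon.mk' t ∈ (toQuotient R (conductor R)).range ↔ t ∈ R := by
  constructor
  · rintro ⟨r, hr⟩
    have h1 : t - r ∈ conductor R := by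
      rw [mem_iff_mk'_eq_zero, map_sub, sub_eq_zero]
      exact hr.symm
    simpa using R.add_mem (conductor_subset h1) r.2
  · exact fun ht => ⟨⟨t, ht⟩, rfl⟩

theorem IsMaximalSubring.range_toQuotient (h : IsMaximalSubring R) :
    IsMaximalSubring (toQuotient R (conductor R)).range := by
  refine ⟨fun htop => h.1 ?_, fun B hB => ?_⟩
  · exact (Subring.eq_top_iff' R).2 fun t => mk'_mem_range_iff.1 (htop ▸ Subring.mem_top _)
  · have hle : R ≤ B.comap (conductor R).ringCon.mk' := fun t ht =>
      hB.le (mk'_mem_range_iff.2 ht)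
    rcases h.eq_top_or_le hle with h' | h'
    · refine (Subring.eq_top_iff' B).2 fun b => ?_
      obtain ⟨t, rfl⟩ := mk'_surjective _ b
      exact Subring.mem_comap.1 (h' ▸ Subring.mem_top t)
    · refine (hB.not_ge fun b hb => ?_).elim
      obtain ⟨t, rfl⟩ := mk'_surjective _ b
      exact mk'_mem_range_iff.2 (h' hb)

theorem conductor_ne_top (h : IsMaximalSubring R) : conductor R ≠ ⊤ := fun h1 =>
  h.1 ((Subring.eq_top_iff' R).2 fun t => conductor_subset (by rw [h1]; trivial))

/-- The equality of conductors says that the image of R has zero left conductor in T/C, so this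
image is prime; it is Artinian as a quotient of R. -/
theorem IsMaximalSubring.isSimpleRing_range (h : IsMaximalSubring R) [IsArtinianRing R]
    (hl : leftConductor R = (conductor R : Set T)) :
    IsSimpleRing (toQuotient R (conductor R)).range := by
  have := nontrivial_quotient (conductor_ne_top h)
  refine isSimpleRing_of_prime (h.range_toQuotient.prime_of_leftConductor fun x hx => ?_)
  obtain ⟨y, rfl⟩ := mk'_surjective _ x
  rw [← mem_iff_mk'_eq_zero]
  have : y ∈ leftConductor R := fun t => mk'_mem_range_iff.1 (by rw [map_mul]; exact hx _)
  rwa [hl] at this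

theorem IsMaximalSubring.isMaximalIdeal_contract_conductor (h : IsMaximalSubring R)
    [IsArtinianRing R] (hl : leftConductor R = (conductor R : Set T)) :
    IsMaximalIdeal (contract R (conductor R)) := by
  have := h.isSimpleRing_range hl
  have h1 := isMaximalIdeal_ker (toQuotient R (conductor R)).rangeRestrict_surjective
  convert h1
  ext x
  rw [← ker_toQuotient, TwoSidedIdeal.mem_ker, TwoSidedIdeal.mem_ker, ← Subtype.val_inj]
  rfl

/-- J(R) maps into the radical of the simple Artinian image of R, which is zero. -/
theorem IsMaximalSubring.jacobson_subset_conductor (h : IsMaximalSubring R)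
    [IsArtinianRing R] (hl : leftConductor R = (conductor R : Set T)) :
    ∀ x ∈ Ring.jacobson R, (x : T) ∈ conductor R := by
  intro x hx
  have := h.isSimpleRing_range hl
  have : RingHomSurjective (toQuotient R (conductor R)).rangeRestrict :=
    ⟨(toQuotient R (conductor R)).rangeRestrict_surjective⟩
  have h1 := Ring.le_comap_jacobson (toQuotient R (conductor R)).rangeRestrict hx
  rw [IsSemisimpleRing.jacobson_eq_bot, Ideal.mem_comap, Ideal.mem_bot] at h1
  rw [mem_iff_mk'_eq_zero]
  exact congrArg Subtype.val h1

/-- A prime ideal not contained in a left Artinian maximal subring has simple quotient. -/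
theorem IsMaximalSubring.isSimpleRing_quotient (h : IsMaximalSubring R) [IsArtinianRing R]
    {N : TwoSidedIdeal T} (hN : IsPrimeIdeal N) (hNR : ¬ (N : Set T) ⊆ R) :
    Function.Surjective (toQuotient R N) ∧ IsSimpleRing N.ringCon.Quotient := by
  have hsurj : Function.Surjective (toQuotient R N) := by
    intro b
    obtain ⟨t, rfl⟩ := mk'_surjective _ b
    obtain ⟨r, hr, htr⟩ := h.exists_sub_mem hNR t
    refine ⟨⟨r, hr⟩, ?_⟩
    rw [mem_iff_mk'_eq_zero, map_sub, sub_eq_zero] at htr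
    exact htr.symm
  have := nontrivial_quotient hN.1
  have : IsArtinianRing N.ringCon.Quotient := hsurj.isArtinianRing
  refine ⟨hsurj, isSimpleRing_of_prime fun a b hab => ?_⟩
  obtain ⟨a, rfl⟩ := mk'_surjective _ a
  obtain ⟨b, rfl⟩ := mk'_surjective _ b
  rw [← mem_iff_mk'_eq_zero, ← mem_iff_mk'_eq_zero]
  refine hN.mem_or_mem fun r => ?_
  rw [mem_iff_mk'_eq_zero, map_mul, map_mul]
  exact hab _

theorem IsMaximalSubring.isMaximalIdeal_of_prime (h : IsMaximalSubring R) [IsArtinianRing R]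
    {N : TwoSidedIdeal T} (hN : IsPrimeIdeal N) (hNR : ¬ (N : Set T) ⊆ R) : IsMaximalIdeal N := by
  have := (h.isSimpleRing_quotient hN hNR).2
  have h1 := isMaximalIdeal_ker (mk'_surjective N)
  rwa [TwoSidedIdeal.ker_ringCon_mk'] at h1

theorem IsMaximalSubring.isMaximalIdeal_contract (h : IsMaximalSubring R) [IsArtinianRing R]
    {N : TwoSidedIdeal T} (hN : IsPrimeIdeal N) (hNR : ¬ (N : Set T) ⊆ R) :
    IsMaximalIdeal (contract R N) := by
  obtain ⟨h1, h2⟩ := h.isSimpleRing_quotient hN hNR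
  rw [← ker_toQuotient]
  exact isMaximalIdeal_ker h1

/-- If the quotient by a proper ideal has at most one nonzero proper ideal, there is a unique
maximal ideal over it. -/
theorem exists_unique_maximal_over {C : TwoSidedIdeal T} (hC : C ≠ ⊤)
    (h : AtMostOneIdeal C.ringCon.Quotient) :
    ∃ Q : TwoSidedIdeal T, IsMaximalIdeal Q ∧ C ≤ Q ∧
      ∀ Q', IsMaximalIdeal Q' → C ≤ Q' → Q' = Q := by
  have hsurj := mk'_surjective C
  have hker : TwoSidedIdeal.ker C.ringCon.mk' = C := TwoSidedIdeal.ker_ringCon_mk' C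
  have hlift : ∀ I, C ≤ I → ∃ K : TwoSidedIdeal C.ringCon.Quotient,
      K.comap C.ringCon.mk' = I := fun I hI => exists_comap_eq hsurj (hker.trans_le hI)
  have hle : ∀ K : TwoSidedIdeal C.ringCon.Quotient, C ≤ K.comap C.ringCon.mk' := by
    intro K
    have := TwoSidedIdeal.comap_le_comap C.ringCon.mk' (bot_le (a := K))
    rwa [comap_bot, hker] at this
  have huniq : ∀ Q Q', IsMaximalIdeal Q → C ≤ Q → IsMaximalIdeal Q' → C ≤ Q' → Q' = Q := by
    intro Q Q' hQ hCQ hQ' hCQ'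
    -- An ideal equal to C corresponds to ⊥, which `AtMostOneIdeal` does not control; maximality
    -- settles this case directly.
    by_cases h1 : Q = C
    · by_contra hne
      exact hQ'.1 (hQ.2 _ (lt_of_le_of_ne (h1.trans_le hCQ') (Ne.symm hne)))
    by_cases h2 : Q' = C
    · by_contra hne
      exact hQ.1 (hQ'.2 _ (lt_of_le_of_ne (h2.trans_le hCQ) hne))
    obtain ⟨K, rfl⟩ := hlift Q hCQ
    obtain ⟨K', rfl⟩ := hlift Q' hCQ'
    have hbot : ∀ K : TwoSidedIdeal C.ringCon.Quotient, K.comap C.ringCon.mk' ≠ C → K ≠ ⊥ := by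
      rintro _ hK rfl
      exact hK ((comap_bot _).trans hker)
    rw [h K' K (hbot _ h2) (fun h => hQ'.1 (comap_eq_top_iff.2 h)) (hbot _ h1)
      fun h => hQ.1 (comap_eq_top_iff.2 h)]
  suffices ∃ Q, IsMaximalIdeal Q ∧ C ≤ Q by
    obtain ⟨Q, hQ, hCQ⟩ := this
    exact ⟨Q, hQ, hCQ, fun Q' hQ' hCQ' => huniq Q Q' hQ hCQ hQ' hCQ'⟩
  by_cases hmax : IsMaximalIdeal C
  · exact ⟨C, hmax, le_rfl⟩
  · have : ∃ I, C < I ∧ I ≠ ⊤ := by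
      by_contra! h'
      exact hmax ⟨hC, h'⟩
    obtain ⟨I, hCI, hI⟩ := this
    refine ⟨I, ⟨hI, fun L hL => ?_⟩, hCI.le⟩
    by_contra hLtop
    obtain ⟨K, rfl⟩ := hlift I hCI.le
    obtain ⟨K', rfl⟩ := hlift L (hCI.le.trans hL.le)
    have hbot : ∀ K : TwoSidedIdeal C.ringCon.Quotient, C < K.comap C.ringCon.mk' → K ≠ ⊥ := by
      rintro _ hK rfl
      exact hK.ne ((comap_bot _).trans hker).symm
    refine hL.ne ?_
    rw [h K K' (hbot _ hCI) (fun h => hI (comap_eq_top_iff.2 h)) (hbot _ (hCI.trans hL))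
      fun h => hLtop (comap_eq_top_iff.2 h)]

theorem AtMostOneIdeal.of_orderIso {A B : Type u} [Ring A] [Ring B] (h : AtMostOneIdeal A)
    (φ : TwoSidedIdeal B ≃o TwoSidedIdeal A) : AtMostOneIdeal B := by
  intro I J hI hI' hJ hJ'
  refine φ.injective (h _ _ ?_ ?_ ?_ ?_)
  · rwa [Ne, map_eq_bot_iff]
  · rwa [Ne, map_eq_top_iff]
  · rwa [Ne, map_eq_bot_iff]
  · rwa [Ne, map_eq_top_iff]

/-- If every prime ideal is maximal or contained in the maximal ideal `Q`, then the dimension is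
the height of `Q`. -/
theorem dim_eq_height {Q : TwoSidedIdeal T} (hQ : IsMaximalIdeal Q)
    (h : ∀ P ∈ Spec T, IsMaximalIdeal P ∨ P ≤ Q) (hQS : Q ∈ Spec T) :
    dim T = ((Order.height (⟨Q, hQS⟩ : Spec T) : ℕ∞) : WithBot ℕ∞) := by
  refine le_antisymm ?_ (Order.height_le_krullDim _)
  rw [dim, Order.krullDim_eq_iSup_height]
  refine iSup_le fun P => WithBot.coe_le_coe.2 ?_
  by_cases hPQ : P.1 ≤ Q
  · exact Order.height_mono (show P ≤ ⟨Q, hQS⟩ from hPQ)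
  · rw [Order.height_eq_iSup_lt_height]
    -- A prime strictly below P is not maximal, so it lies strictly below Q; thus P is no higher
    -- than Q.
    refine iSup₂_le fun P' hP' => Order.height_add_one_le ?_
    have hlt : P'.1 < P.1 := hP'
    have hnm : ¬ IsMaximalIdeal P'.1 := fun hm => P.2.1 (hm.2 _ hlt)
    exact lt_of_le_of_ne ((h _ P'.2).resolve_left hnm) fun h' => hnm (h' ▸ hQ)

end Conductor

/-! ### Contraction of maximal ideals to R. -/

section MaximalIdeals

variable {T : Type u} [Ring T] {R : Subring T}

theorem isMaximalIdeal_eq_of_le {M N : TwoSidedIdeal T} (hM : IsMaximalIdeal M)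
    (hN : IsMaximalIdeal N) (h : M ≤ N) : M = N := by
  by_contra hne
  exact hN.1 (hM.2 _ (lt_of_le_of_ne h hne))

/-- Maximal ideals not containing the conductor are determined by their contractions. -/
theorem contract_injective {N₁ N₂ : TwoSidedIdeal T} (h₁ : IsMaximalIdeal N₁)
    (h₂ : IsMaximalIdeal N₂) (hC : ¬ conductor R ≤ N₂)
    (h : contract R N₁ = contract R N₂) : N₁ = N₂ := by
  -- The product of the conductor with N₁ lies in R ∩ N₁ = R ∩ N₂, so primeness of N₂ gives N₁ ≤ N₂.
  refine isMaximalIdeal_eq_of_le h₁ h₂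
    ((h₂.isPrimeIdeal.2 (conductor R) N₁ fun x hx y hy => ?_).resolve_left hC)
  have hxy : x * y ∈ R := conductor_subset ((conductor R).mul_mem_right _ _ hx)
  have h3 : (⟨x * y, hxy⟩ : R) ∈ contract R N₁ :=
    (TwoSidedIdeal.mem_comap _).2 (N₁.mul_mem_left _ _ hy)
  rw [h] at h3
  exact (TwoSidedIdeal.mem_comap _).1 h3

theorem le_of_contract_conductor_le {N : TwoSidedIdeal T}
    (h : contract R (conductor R) ≤ contract R N) : conductor R ≤ N := fun x hx =>
  (TwoSidedIdeal.mem_comap R.subtype).1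
    (@h ⟨x, conductor_subset hx⟩ ((TwoSidedIdeal.mem_comap R.subtype).2 hx))

/-- The prime and maximal spectrum of a ring with a left Artinian maximal subring, when there is a
unique maximal ideal over the conductor. -/
theorem IsMaximalSubring.spectrum (h : IsMaximalSubring R) [IsArtinianRing R]
    (hl : leftConductor R = (conductor R : Set T)) {Q : TwoSidedIdeal T} (hQ : IsMaximalIdeal Q)
    (hCQ : conductor R ≤ Q) (huniq : ∀ Q', IsMaximalIdeal Q' → conductor R ≤ Q' → Q' = Q) :
    Max T = {Q} ∪ {N | N ∈ Spec T ∧ ¬ (N : Set T) ⊆ (R : Set T)} ∧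
    (∀ P ∈ Spec T, IsMaximalIdeal P ∨ P ≤ Q) ∧
    (∃ hQ : Q ∈ Spec T, dim T = ((Order.height (⟨Q, hQ⟩ : Spec T) : ℕ∞) : WithBot ℕ∞)) ∧
    (∀ N₁ N₂ : TwoSidedIdeal T, IsMaximalIdeal N₁ → IsMaximalIdeal N₂ → N₁ ≠ N₂ → N₁ ≠ Q →
      N₂ ≠ Q → contract R N₁ ≠ contract R N₂) ∧
    Cardinal.mk (Max T) ≤ Cardinal.mk (Max R) := by
  have hnot : ∀ N, IsMaximalIdeal N → N ≠ Q → ¬ (N : Set T) ⊆ R := fun N hN hNQ hNR =>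
    hNQ (isMaximalIdeal_eq_of_le hN hQ ((le_conductor_iff.2 hNR).trans hCQ))
  have hspec : ∀ P ∈ Spec T, IsMaximalIdeal P ∨ P ≤ Q := fun P hP => by
    by_cases hPR : (P : Set T) ⊆ R
    · exact Or.inr ((le_conductor_iff.2 hPR).trans hCQ)
    · exact Or.inl (h.isMaximalIdeal_of_prime hP hPR)
  have hinj : ∀ N₁ N₂ : TwoSidedIdeal T, IsMaximalIdeal N₁ → IsMaximalIdeal N₂ → N₂ ≠ Q →
      contract R N₁ = contract R N₂ → N₁ = N₂ := fun N₁ N₂ h₁ h₂ hne =>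
    contract_injective h₁ h₂ fun hC => hne (huniq _ h₂ hC)
  refine ⟨?_, hspec, ⟨hQ.isPrimeIdeal, dim_eq_height hQ hspec _⟩,
    fun N₁ N₂ h₁ h₂ hne _ h₂Q heq => hne (hinj N₁ N₂ h₁ h₂ h₂Q heq), ?_⟩
  · ext N
    constructor
    · intro hN
      by_cases hNQ : N = Q
      · exact Or.inl hNQ
      · exact Or.inr ⟨IsMaximalIdeal.isPrimeIdeal hN, hnot N hN hNQ⟩
    · rintro (rfl | ⟨hN, hNR⟩)
      · exact hQ
      · exact h.isMaximalIdeal_of_prime hN hNR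
  · classical
    have hCmax := h.isMaximalIdeal_contract_conductor hl
    have hkey : ∀ N, IsMaximalIdeal N → N ≠ Q →
        contract R (conductor R) ≠ contract R N := fun N hN hNQ heq =>
      hNQ (huniq N hN (le_of_contract_conductor_le heq.le))
    -- Q is sent to the contracted conductor, which is maximal in R. No other N attains this value,
    -- as it would then contain the conductor.
    let f : Max T → Max R := fun N =>
      if hNQ : N.1 = Q then ⟨contract R (conductor R), hCmax⟩
      else ⟨contract R N.1,
        h.isMaximalIdeal_contract (IsMaximalIdeal.isPrimeIdeal N.2) (hnot _ N.2 hNQ)⟩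
    refine Cardinal.mk_le_of_injective (f := f) fun N₁ N₂ heq => Subtype.ext ?_
    by_cases h₁ : N₁.1 = Q <;> by_cases h₂ : N₂.1 = Q <;>
      simp only [f, h₁, h₂, dite_true, dite_false] at heq
    · rw [h₁, h₂]
    · exact (hkey _ N₂.2 h₂ (congrArg Subtype.val heq)).elim
    · exact (hkey _ N₁.2 h₁ (congrArg Subtype.val heq).symm).elim
    · exact hinj _ _ N₁.2 N₂.2 h₂ (congrArg Subtype.val heq)

end MaximalIdeals
end MaxSubring

/-! ### Assembly of the theorem. -/

theorem mainTheorem12 {T : Type*} [Ring T] (R : Subring T)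
    (hmax : MaxSubring.IsMaximalSubring R)
    (hart : IsArtinianRing R)
    (hl : MaxSubring.leftConductor R = (MaxSubring.conductor R : Set T))
    (hr : MaxSubring.rightConductor R = (MaxSubring.conductor R : Set T)) :
    ∃ (n : ℕ) (S : Type _) (_ : Ring S),
      0 < n ∧
      Nonempty ((MaxSubring.conductor R).ringCon.Quotient ≃+* Matrix (Fin n) (Fin n) S) ∧
      (∃ D : Subring S, MaxSubring.IsMaximalSubring D ∧ MaxSubring.IsDivisionRing D) ∧
      ((IsArtinianRing T ∧ Ring.jacobson R = (Ring.jacobson T).comap R.subtype) ∨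
        MaxSubring.FewIdeals R S) ∧
      (MaxSubring.AtMostOneIdeal S →
        ∃ Q : TwoSidedIdeal T,
          (MaxSubring.IsMaximalIdeal Q ∧ MaxSubring.conductor R ≤ Q ∧
            ∀ Q' : TwoSidedIdeal T,
              MaxSubring.IsMaximalIdeal Q' → MaxSubring.conductor R ≤ Q' → Q' = Q) ∧
          MaxSubring.Max T =
            {Q} ∪ {N | N ∈ MaxSubring.Spec T ∧ ¬ (N : Set T) ⊆ (R : Set T)} ∧
          (∀ P ∈ MaxSubring.Spec T, MaxSubring.IsMaximalIdeal P ∨ P ≤ Q) ∧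
          (∃ hQ : Q ∈ MaxSubring.Spec T,
            MaxSubring.dim T =
              ((Order.height (⟨Q, hQ⟩ : MaxSubring.Spec T) : ℕ∞) : WithBot ℕ∞)) ∧
          (∀ N₁ N₂ : TwoSidedIdeal T, MaxSubring.IsMaximalIdeal N₁ →
            MaxSubring.IsMaximalIdeal N₂ → N₁ ≠ N₂ → N₁ ≠ Q → N₂ ≠ Q →
            MaxSubring.contract R N₁ ≠ MaxSubring.contract R N₂) ∧
          Cardinal.mk (MaxSubring.Max T) ≤ Cardinal.mk (MaxSubring.Max R)) := by
  obtain ⟨n, S, _, hn, ⟨e⟩, D, hDmax, hD⟩ := by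
    have := hmax.isSimpleRing_range hl
    exact hmax.range_toQuotient.exists_matrix
  have : NeZero n := ⟨hn.ne'⟩
  -- Ideals of 𝕄ₙ(S) correspond to ideals of S, so ideal counts for S transfer to T/C.
  let φ : TwoSidedIdeal (MaxSubring.conductor R).ringCon.Quotient ≃o TwoSidedIdeal S :=
    e.mapTwoSidedIdeal.trans (TwoSidedIdeal.orderIsoMatrix (n := Fin n)).symm
  refine ⟨n, S, inferInstance, hn, ⟨e⟩, ⟨D, hDmax, hD⟩, ?_, fun hS => ?_⟩
  · by_cases hS : MaxSubring.AtMostOneIdeal S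
    · refine Or.inr ⟨hS, hS.of_orderIso φ, (hDmax.trichotomy hD hS).imp_left fun hsimple => ?_⟩
      have : IsSimpleRing S := hsimple
      refine ⟨hsimple, ?_⟩
      have : IsSimpleRing (MaxSubring.conductor R).ringCon.Quotient :=
        IsSimpleRing.of_ringEquiv e.symm (IsSimpleRing.matrix (Fin n) S)
      have h1 := MaxSubring.isMaximalIdeal_ker
        (MaxSubring.mk'_surjective (MaxSubring.conductor R))
      rwa [TwoSidedIdeal.ker_ringCon_mk'] at h1
    · have := hDmax.isArtinianRing_of_not_atMostOneIdeal hD hS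
      have : IsArtinianRing (MaxSubring.conductor R).ringCon.Quotient :=
        e.symm.surjective.isArtinianRing
      have hT : IsArtinianRing T :=
        MaxSubring.isArtinianRing_of_quotient (MaxSubring.conductor_subset (R := R))
      exact Or.inl ⟨hT, le_antisymm
        (MaxSubring.jacobson_le_comap MaxSubring.conductor_subset
          (hmax.jacobson_subset_conductor hl))
        MaxSubring.comap_jacobson_le⟩
  · obtain ⟨Q, hQ, hCQ, huniq⟩ := MaxSubring.exists_unique_maximal_over
      (MaxSubring.conductor_ne_top hmax) (hS.of_orderIso φ)
    exact ⟨Q, ⟨hQ, hCQ, huniq⟩, hmax.spectrum hl hQ hCQ huniq⟩
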